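/- Let $\mathbb{F}$ be a field, $R=\mathbb{F}[U,V]$, and $A=R[X]/((X-U)(X-V))$, the Frobenius algebra with $\Delta(1)=X\otimes 1+1\otimes X-(U+V)\,1\otimes 1$ and $\Delta(X)=X\otimes X-UV\,1\otimes 1$. Let $L$ be an oriented link and $D$ any planar diagram of $L$, with $n_+$ positive and $n_-$ negative crossings. Let $CKh(D)$ be the Khovanov complex of $D$ built from $(R,A)$: it is the free $R$-module on the Khovanov generators $g$, that is, on the labelings by $1$ or $X$ of the circles of the complete resolutions $D_u$, $u\in\{0,1\}^{n_++n_-}$, with the differential given by the signed merge and split maps. Put $\operatorname{gr}_q(g)=\#\{\text{labels }1\}-\#\{\text{labels }X\}+|u|+n_+-2n_-$. For $t\in[0,2]$ and $\lambda\in\mathbb{R}$, let $F^t_\lambda\subseteq CKh(D)$ be the $\mathbb{F}$-span of all $U^mV^ng$ with $\operatorname{gr}_q(g)-(tm+(2-t)n)\ge\lambda$. The filtration $F^t$ induces filtrations on the homology $Kh(D)$ and on its quotient $Kh(D)/T(D)$ by the $R$-torsion submodule. Let $\operatorname{gr}_t(\bar\eta)$ be the supremum of all $\lambda$ such that $\bar\eta\in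 Kh(D)/T(D)$ lies in level $\lambda$ of the induced filtration. Define $$s_t(L)=s_t(D)=\sup\{\operatorname{gr}_t(\bar\eta) : 0\neq\bar\eta\in Kh(D)/T(D)\}-1 .$$ Then $s_t(L)$ is a (finite) real number for every $t\in[0,2]$, and the function $t\mapsto s_t(L)$ on $[0,2]$ is continuous, piecewise linear (with finitely many pieces), and differentiable at all but finitely many points of $[0,2]$. -/

import Mathlib

open Set

noncomputable section

/-! ## Oriented planar link diagrams -/

/-- The half-edges of a diagram with `n` crossings: four at each crossing. At a crossing the
half-edges `0, 1, 2, 3` are listed counterclockwise, and `0` is the incoming half-edge of the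
strand passing under, so that `2` is the outgoing half-edge of the strand passing under, while
`1` and `3` belong to the strand passing over. -/
abbrev HalfEdge (n : ℕ) : Type := Fin n × Fin 4

/-- Rotation of the half-edges around each crossing by one step counterclockwise. -/
def rotateCCW {n : ℕ} (x : HalfEdge n) : HalfEdge n := (x.1, x.2 + 1)

/-- Whether a half-edge points towards its crossing, given which crossings are positive
(`pos c = true`). The over-strand runs from `3` to `1` at a positive crossing and from `1` to `3`
at a negative one. -/
def isIncoming {n : ℕ} (pos : Fin n → Bool) (x : HalfEdge n) : Bool :=
  match x.2 with
  | 0 => true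
  | 1 => !pos x.1
  | 2 => false
  | 3 => pos x.1

/-- An oriented link diagram in the plane, as a planar combinatorial map. It consists of `n`
crossings, whose half-edges are joined in pairs by `edge`, together with `loops` closed components
without crossings. Components of the underlying graph may be placed in the plane in various ways
relative to each other; this is not recorded because the Khovanov complex does not see it. -/
structure LinkDiagram where
  /-- number of crossings -/
  n : ℕ
  /-- number of crossingless circles -/
  loops : ℕ
  /-- `pos c = true` if and only if the crossing `c` is positive -/
  pos : Fin n → Bool
  /-- the other half of the edge to which a half-edge belongs -/
  edge : HalfEdge n → HalfEdge n
  edge_edge : ∀ x, edge (edge x) = x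
  /-- every edge leaves one crossing and enters one -/
  isIncoming_edge : ∀ x, isIncoming pos (edge x) = !isIncoming pos x
  /-- Every connected component of the underlying graph has genus zero: `V - E + F = 2 C`, where
  there are `V = n` crossings and `E = 2 n` edges, the `F` faces are the cycles of the permutation
  `x ↦ rotateCCW (edge x)`, and `C` is the number of connected components of the graph. -/
  planar :
    Nat.card (Quot fun x y : HalfEdge n => y = rotateCCW (edge x)) =
      n + 2 * Nat.card (Quot fun x y : HalfEdge n => y = edge x ∨ y = rotateCCW x)

namespace LinkDiagram

variable (D : LinkDiagram)

/-- The number of positive crossings. -/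
def nPos : ℕ := Nat.card {c : Fin D.n // D.pos c = true}

/-- The number of negative crossings. -/
def nNeg : ℕ := Nat.card {c : Fin D.n // D.pos c = false}

/-! ## The cube of resolutions -/

/-- A vertex of the cube of resolutions: `u c = false` is the `0`-smoothing at the crossing `c`,
and `u c = true` is the `1`-smoothing. -/
abbrev Vertex : Type := Fin D.n → Bool

/-- The half-edge to which a given one is connected near its crossing in the resolution `u`. The
`0`-smoothing connects `0` with `1` and `2` with `3` (for a positive crossing this is the oriented
smoothing); the `1`-smoothing connects `0` with `3` and `1` with `2`. -/
def smooth (u : D.Vertex) (x : HalfEdge D.n) : HalfEdge D.n :=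
  (x.1, if u x.1 then ![3, 2, 1, 0] x.2 else ![1, 0, 3, 2] x.2)

/-- The circles of the resolution `D_u`. -/
abbrev Circle (u : D.Vertex) : Type :=
  (Quot fun x y : HalfEdge D.n => y = D.edge x ∨ y = D.smooth u x) ⊕ Fin D.loops

/-- The circle of `D_u` on which a half-edge lies. -/
def circleOf (u : D.Vertex) (x : HalfEdge D.n) : D.Circle u := Sum.inl (Quot.mk _ x)

instance (u : D.Vertex) : Fintype (D.Circle u) := Fintype.ofFinite _

/-- The Khovanov generators: a vertex `u` of the cube, and a label `1` or `X` on each circle of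
`D_u`. The label `1` is encoded as `false` and the label `X` as `true`. -/
structure Gen where
  u : D.Vertex
  label : D.Circle u → Bool

instance : Finite D.Gen :=
  Finite.of_injective
    (fun G : D.Gen => (⟨G.u, G.label⟩ : (u : D.Vertex) × (D.Circle u → Bool)))
    (by rintro ⟨u, g⟩ ⟨v, h⟩ e; simpa using e)

instance : Fintype D.Gen := Fintype.ofFinite _

/-- The height `|u|` of a vertex of the cube. -/
def height (u : D.Vertex) : ℕ := ∑ c, if u c then 1 else 0

/-- The quantum grading of a Khovanov generator, where `1` has grading `1` and `X` has
grading `-1`. -/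
def grq (G : D.Gen) : ℤ :=
  (∑ C, if G.label C then (-1 : ℤ) else 1) + D.height G.u + D.nPos - 2 * D.nNeg

end LinkDiagram

/-! ## The Frobenius algebra -/

section Frobenius

variable (F : Type*) [Field F]

/-- The ground ring `R = F[U, V]`. -/
abbrev GroundRing : Type _ := MvPolynomial (Fin 2) F

/-- The variable `U`. -/
abbrev varU : GroundRing F := MvPolynomial.X 0

/-- The variable `V`. -/
abbrev varV : GroundRing F := MvPolynomial.X 1

/-- Structure constants of the multiplication of `A = R[X]/((X-U)(X-V))` in the basis `1, X`:
`mulCoeff F a b c` is the coefficient of `c` in `a * b`, where `X * X = (U+V) X - UV`. -/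
def mulCoeff : Bool → Bool → Bool → GroundRing F
  | false, false, false => 1
  | false, true, true => 1
  | true, false, true => 1
  | true, true, true => varU F + varV F
  | true, true, false => -(varU F * varV F)
  | _, _, _ => 0

/-- Structure constants of the comultiplication of `A`: `comulCoeff F a b c` is the coefficient of
`b ⊗ c` in `Δ a`, where `Δ 1 = X ⊗ 1 + 1 ⊗ X - (U+V) 1 ⊗ 1` and `Δ X = X ⊗ X - UV 1 ⊗ 1`. -/
def comulCoeff : Bool → Bool → Bool → GroundRing F
  | false, true, false => 1
  | false, false, true => 1
  | false, false, false => -(varU F + varV F)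
  | true, true, true => 1
  | true, false, false => -(varU F * varV F)
  | _, _, _ => 0

end Frobenius

namespace LinkDiagram

variable (F : Type*) [Field F] (D : LinkDiagram)

/-! ## The complex and its homology -/

open Classical in
/-- The coefficient of the generator `H` in the image of the generator `G` under the saddle at the
crossing `c`, where `H.u` is `G.u` with the `c`-th entry changed from `0` to `1`. The two strands
near `c` contain the half-edges `0` and `2` of `c`, both in `D_{G.u}` and in `D_{H.u}`. If they lie
on different circles of `D_{G.u}`, these circles are merged, otherwise their common circle is
split. All other circles keep their labels. -/
def saddleCoeff (c : Fin D.n) (G H : D.Gen) : GroundRing F :=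
  if (∀ x : HalfEdge D.n, D.circleOf G.u x ≠ D.circleOf G.u (c, 0) →
        D.circleOf G.u x ≠ D.circleOf G.u (c, 2) →
        H.label (D.circleOf H.u x) = G.label (D.circleOf G.u x)) ∧
      (∀ l : Fin D.loops, H.label (Sum.inr l) = G.label (Sum.inr l)) then
    if D.circleOf G.u (c, 0) ≠ D.circleOf G.u (c, 2) then
      mulCoeff F (G.label (D.circleOf G.u (c, 0))) (G.label (D.circleOf G.u (c, 2)))
        (H.label (D.circleOf H.u (c, 0)))
    else
      comulCoeff F (G.label (D.circleOf G.u (c, 0)))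
        (H.label (D.circleOf H.u (c, 0))) (H.label (D.circleOf H.u (c, 2)))
  else 0

/-- The sign of the edge of the cube that starts at `u` in the direction of the crossing `c`. -/
def edgeSign (u : D.Vertex) (c : Fin D.n) : GroundRing F :=
  (-1) ^ (∑ c' : Fin D.n, if c' < c ∧ u c' = true then 1 else 0)

/-- The matrix of the differential: `diffMatrix F D H G` is the coefficient of `H` in `d G`. -/
def diffMatrix : Matrix D.Gen D.Gen (GroundRing F) := fun H G =>
  ∑ c : Fin D.n,
    if G.u c = false ∧ H.u = Function.update G.u c true then
      edgeSign F D G.u c * saddleCoeff F D c G H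
    else 0

/-- The total chain module `CKh(D)`, the free `R`-module on the Khovanov generators. -/
abbrev CKh : Type _ := D.Gen → GroundRing F

/-- The differential of `CKh(D)`. -/
def diff : CKh F D →ₗ[GroundRing F] CKh F D := (diffMatrix F D).mulVecLin

/-- The cycles. -/
abbrev Cycles : Submodule (GroundRing F) (CKh F D) := LinearMap.ker (diff F D)

/-- The boundaries, inside the cycles. -/
abbrev Boundaries : Submodule (GroundRing F) (Cycles F D) :=
  (LinearMap.range (diff F D)).submoduleOf (Cycles F D)

/-- The homology `Kh(D)`, in all homological degrees together. -/
abbrev Kh : Type _ := Cycles F D ⧸ Boundaries F D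

/-- The quotient of `Kh(D)` by its `R`-torsion submodule. -/
abbrev KhFree : Type _ := Kh F D ⧸ Submodule.torsion (GroundRing F) (Kh F D)

/-! ## The filtrations -/

/-- The grading `gr_t` of the element `U ^ m * V ^ k * G` of the distinguished `F`-basis. -/
def grt (t : ℝ) (m k : ℕ) (G : D.Gen) : ℝ := D.grq G - (t * m + (2 - t) * k)

open Classical in
/-- The filtration `F^t` of `CKh(D)`: at level `a` it is the `F`-span of all basis elements
`U ^ m * V ^ k * G` with `gr_t ≥ a`. -/
def filCKh (t a : ℝ) : Submodule F (CKh F D) :=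
  Submodule.span F {z | ∃ (m k : ℕ) (G : D.Gen), a ≤ grt D t m k G ∧
    z = Pi.single G (varU F ^ m * varV F ^ k)}

/-- The induced filtration on the cycles. -/
def filCycles (t a : ℝ) : Submodule F (Cycles F D) :=
  (filCKh F D t a).comap ((Cycles F D).subtype.restrictScalars F)

/-- The induced filtration on `Kh(D)`. -/
def filKh (t a : ℝ) : Submodule F (Kh F D) :=
  (filCycles F D t a).map ((Boundaries F D).mkQ.restrictScalars F)

/-- The induced filtration on the quotient of `Kh(D)` by its torsion. -/
def filKhFree (t a : ℝ) : Submodule F (KhFree F D) :=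
  (filKh F D t a).map
    ((Submodule.torsion (GroundRing F) (Kh F D)).mkQ.restrictScalars F)

/-- The grading of an element of `Kh(D)/T(D)` induced by the filtration, with values in the
extended reals. -/
def grElem (t : ℝ) (η : KhFree F D) : EReal :=
  sSup {a : EReal | ∃ b : ℝ, η ∈ filKhFree F D t b ∧ a = (b : EReal)}

/-- The number `gr_t(D)`: the supremum of the gradings of the nonzero elements of `Kh(D)/T(D)`. -/
def grDiagram (t : ℝ) : EReal :=
  sSup {a : EReal | ∃ η : KhFree F D, η ≠ 0 ∧ a = grElem F D t η}

/-- The invariant `s_t` of the oriented link with diagram `D`, as an extended real number. -/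
def sInvariant (t : ℝ) : EReal := grDiagram F D t - 1

end LinkDiagram

/-- `f` is piecewise linear on `[a, b]`: there are finitely many points
`a = p 0 < p 1 < ... < p N = b` such that `f` is affine on each `[p i, p (i + 1)]`. -/
def IsPiecewiseLinearOn (f : ℝ → ℝ) (a b : ℝ) : Prop :=
  ∃ (N : ℕ) (p : ℕ → ℝ), p 0 = a ∧ p N = b ∧ (∀ i < N, p i < p (i + 1)) ∧
    ∀ i < N, ∃ α β : ℝ, ∀ x ∈ Icc (p i) (p (i + 1)), f x = α * x + β

end

/-! The filtration level of a chain is the minimum of the gradings of the basis elements `U^m V^n g`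
that occur in it, and each such grading is affine in `t`. So `gr_t(D)` is a supremum of such minima
over all cycles with nonzero class modulo torsion. The difficulty is that there are infinitely many
such cycles.

For `t ∈ [0, 2]`, multiplication by `U` or `V` never raises a grading. A cycle `z` is therefore
superfluous once there is a competing cycle each of whose basis elements divides one occurring in
`z`. Divisibility of basis elements is a well-quasi-order (Dickson), and Higman's lemma extends this
to finite sets of them, so finitely many cycles suffice, the same ones for all `t`
(`exists_finset_forall_dominates`). Hence `gr_t(D)` is a finite maximum of finite minima of affine
functions (`exists_grDiagram_eq`), which gives all the regularity claims.

This maximum is over a nonempty set because `Kh(D)/T(D) ≠ 0` (`exists_freeClass_ne_zero`). A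
Lee-type cycle on the oriented resolution, a tensor product of factors `X - U` and `X - V`, is
detected by a functional that vanishes on boundaries. Both need a two-colouring of the oriented
circles (`exists_colouring`); it comes from a checkerboard colouring, hence from planarity by an
Euler characteristic count modulo two. -/

noncomputable section

/-! ### Planarity and the checkerboard colouring -/

namespace LinkDiagram

variable (D : LinkDiagram)

/-- The faces of the underlying planar map. -/
abbrev Face : Type := Quot fun x y : HalfEdge D.n => y = rotateCCW (D.edge x)

/-- The connected components of the underlying graph. -/
abbrev Component : Type := Quot fun x y : HalfEdge D.n => y = D.edge x ∨ y = rotateCCW x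

/-- The edges of the diagram, represented by their halves that point to a crossing. -/
abbrev Edge : Type := {x : HalfEdge D.n // isIncoming D.pos x = true}

instance : Fintype D.Face := Fintype.ofFinite _
instance : Fintype D.Component := Fintype.ofFinite _

theorem card_edge : Fintype.card D.Edge = 2 * D.n := by
  have e : D.Edge ≃ (c : Fin D.n) × {i : Fin 4 // isIncoming D.pos (c, i) = true} :=
    { toFun := fun x => ⟨x.1.1, x.1.2, x.2⟩
      invFun := fun x => ⟨(x.1, x.2.1), x.2.2⟩
      left_inv := fun _ => rfl
      right_inv := fun _ => rfl }
  rw [Fintype.card_congr e, Fintype.card_sigma, Finset.sum_congr rfl (g := fun _ => 2)]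
  · simp [mul_comm]
  · intro c _
    rw [Fintype.card_subtype]
    cases h : D.pos c <;> simp [isIncoming, h, Finset.filter, Fin.univ_succ]; rfl

/-- The boundary map from faces to edges modulo two. -/
def faceBoundary : (D.Face → ZMod 2) →ₗ[ZMod 2] (D.Edge → ZMod 2) where
  toFun p e := p (Quot.mk _ e.1) + p (Quot.mk _ (D.edge e.1))
  map_add' p q := by ext e; simp only [Pi.add_apply]; ring
  map_smul' a p := by ext e; simp only [Pi.smul_apply, smul_eq_mul, RingHom.id_apply]; ring

/-- The incidence matrix of crossings and edges modulo two. -/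
def incidence : Matrix (Fin D.n) D.Edge (ZMod 2) := fun c e =>
  (if e.1.1 = c then 1 else 0) + (if (D.edge e.1).1 = c then 1 else 0)

theorem forall_edge_pair {P : HalfEdge D.n → HalfEdge D.n → Prop} (symm : ∀ x y, P x y → P y x)
    (h : ∀ e : D.Edge, P e.1 (D.edge e.1)) (x : HalfEdge D.n) : P x (D.edge x) := by
  by_cases hx : isIncoming D.pos x = true
  · exact h ⟨x, hx⟩
  · have := h ⟨D.edge x, by rw [D.isIncoming_edge]; simpa using hx⟩
    rw [D.edge_edge] at this
    exact symm _ _ this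

theorem face_mk_edge (x : HalfEdge D.n) :
    (Quot.mk _ (D.edge x) : D.Face) = Quot.mk _ (rotateCCW x) :=
  Quot.sound (by rw [D.edge_edge])

/-- A kernel element agrees on the two sides of every edge. Since `edge x` and `rotateCCW x` lie on
one face, it is invariant under both relations defining a component. -/
theorem finrank_ker_faceBoundary_le :
    Module.finrank (ZMod 2) (LinearMap.ker D.faceBoundary) ≤ Nat.card D.Component := by
  have key : ∀ p ∈ LinearMap.ker D.faceBoundary, ∀ x : HalfEdge D.n,
      p (Quot.mk _ x) = p (Quot.mk _ (D.edge x)) := by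
    intro p hp
    refine D.forall_edge_pair (P := fun x y => p (Quot.mk _ x) = p (Quot.mk _ y))
      (fun _ _ h => h.symm) fun e => ?_
    have := congrFun (LinearMap.mem_ker.1 hp) e
    exact (CharTwo.add_eq_zero).1 this
  let f : LinearMap.ker D.faceBoundary →ₗ[ZMod 2] (D.Component → ZMod 2) :=
    { toFun := fun p => Quot.lift (fun x => p.1 (Quot.mk _ x)) (by
        rintro x y (rfl | rfl)
        · exact key p.1 p.2 x
        · rw [← D.face_mk_edge]; exact key p.1 p.2 x)
      map_add' := fun p q => by ext x; induction x using Quot.ind; rfl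
      map_smul' := fun a p => by ext x; induction x using Quot.ind; rfl }
  have hf : Function.Injective f := by
    intro p q h
    ext x
    induction x using Quot.ind with
    | mk x => exact congrFun h (Quot.mk _ x)
  simpa using LinearMap.finrank_le_finrank_of_injective hf

theorem finrank_ker_incidence_transpose_le :
    Module.finrank (ZMod 2) (LinearMap.ker D.incidence.transpose.mulVecLin) ≤
      Nat.card D.Component := by
  have key : ∀ v ∈ LinearMap.ker D.incidence.transpose.mulVecLin, ∀ x : HalfEdge D.n,
      v x.1 = v (D.edge x).1 := by
    intro v hv
    refine D.forall_edge_pair (P := fun x y => v x.1 = v y.1) (fun _ _ h => h.symm) fun e => ?_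
    have := congrFun (LinearMap.mem_ker.1 hv) e
    simp only [Matrix.mulVecLin_apply, Matrix.mulVec, dotProduct, Matrix.transpose_apply,
      incidence, add_mul, Finset.sum_add_distrib, ite_mul, one_mul, zero_mul,
      Finset.sum_ite_eq, Finset.mem_univ, if_true, Pi.zero_apply] at this
    exact (CharTwo.add_eq_zero).1 this
  let f : LinearMap.ker D.incidence.transpose.mulVecLin →ₗ[ZMod 2] (D.Component → ZMod 2) :=
    { toFun := fun v => Quot.lift (fun x => v.1 x.1) (by
        rintro x y (rfl | rfl)
        · exact key v.1 v.2 x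
        · rfl)
      map_add' := fun p q => by ext x; induction x using Quot.ind; rfl
      map_smul' := fun a p => by ext x; induction x using Quot.ind; rfl }
  have hf : Function.Injective f := by
    intro p q h
    ext c
    exact congrFun h (Quot.mk _ (c, 0))
  simpa using LinearMap.finrank_le_finrank_of_injective hf

/-- Exactly one half of each edge is incoming. -/
theorem sum_edge (g : HalfEdge D.n → ZMod 2) :
    ∑ e : D.Edge, (g e.1 + g (D.edge e.1)) = ∑ x, g x := by
  rw [Finset.sum_add_distrib, ← Fintype.sum_subtype_add_sum_subtype
    (fun x => isIncoming D.pos x = true) g]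
  congr 1
  refine Fintype.sum_equiv
    ⟨fun e => ⟨D.edge e.1, by rw [D.isIncoming_edge, e.2]; simp⟩,
      fun e => ⟨D.edge e.1, by rw [D.isIncoming_edge]; simpa using e.2⟩,
      fun e => Subtype.ext (D.edge_edge _), fun e => Subtype.ext (D.edge_edge _)⟩ _ _ fun e => rfl

theorem incidence_mulVec (q : HalfEdge D.n → ZMod 2) (hq : ∀ x, q (D.edge x) = q x)
    (c : Fin D.n) : D.incidence.mulVec (fun e => q e.1) c = ∑ i, q (c, i) := by
  have := D.sum_edge fun x => (if x.1 = c then 1 else 0) * q x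
  simp only [hq, ← add_mul] at this
  refine Eq.trans this ?_
  rw [Fintype.sum_prod_type, Finset.sum_eq_single c]
  · simp
  · intro b _ hb; simp [hb]
  · simp

/-- Around a crossing, each of the four corners is counted by two consecutive half-edges, so the sum
vanishes modulo two. -/
theorem range_faceBoundary_le :
    LinearMap.range D.faceBoundary ≤ LinearMap.ker D.incidence.mulVecLin := by
  rintro _ ⟨p, rfl⟩
  rw [LinearMap.mem_ker]
  ext c
  refine (D.incidence_mulVec (fun x => p (Quot.mk _ x) + p (Quot.mk _ (D.edge x)))
    (fun x => by rw [D.edge_edge, add_comm]) c).trans ?_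
  simp only [face_mk_edge, Finset.sum_add_distrib]
  have := Equiv.sum_comp (Equiv.addRight (1 : Fin 4)) fun i => p (Quot.mk _ (c, i))
  exact (congrArg _ this).trans (CharTwo.add_self_eq_zero _)

/-- Exactness by counting, with `C` components. The Euler formula makes the rank of `faceBoundary`
at least `(n + 2C) - C = n + C`. Row rank equals column rank, so `incidence` has rank at least `n -
C` and its kernel has dimension at most `2n - (n - C) = n + C`. -/
theorem range_faceBoundary :
    LinearMap.range D.faceBoundary = LinearMap.ker D.incidence.mulVecLin := by
  refine Submodule.eq_of_le_of_finrank_le D.range_faceBoundary_le ?_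
  have h1 := D.faceBoundary.finrank_range_add_finrank_ker
  have h2 := D.incidence.mulVecLin.finrank_range_add_finrank_ker
  have h3 := D.incidence.transpose.mulVecLin.finrank_range_add_finrank_ker
  have h4 := D.finrank_ker_faceBoundary_le
  have h5 := D.finrank_ker_incidence_transpose_le
  have h6 : Module.finrank (ZMod 2) (LinearMap.range D.incidence.transpose.mulVecLin) =
    Module.finrank (ZMod 2) (LinearMap.range D.incidence.mulVecLin) := D.incidence.rank_transpose
  have h7 : Nat.card D.Face = D.n + 2 * Nat.card D.Component := D.planar
  have h8 := D.card_edge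
  simp only [Module.finrank_fintype_fun_eq_card, Fintype.card_fin, Nat.card_eq_fintype_card]
    at h1 h2 h3 h4 h5 h7
  omega

/-- The faces of a planar diagram admit a checkerboard colouring. -/
theorem exists_checkerboard : ∃ f : HalfEdge D.n → ZMod 2,
    (∀ x, f (D.edge x) = f x + 1) ∧ ∀ x, f (rotateCCW x) = f x + 1 := by
  -- The sum of all edges is a cycle because every crossing has even valence; a set of faces
  -- bounding it is the colouring.
  have h : (fun _ => 1 : D.Edge → ZMod 2) ∈ LinearMap.range D.faceBoundary := by
    rw [range_faceBoundary, LinearMap.mem_ker]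
    ext c
    refine (D.incidence_mulVec (fun _ => 1) (fun _ => rfl) c).trans ?_
    simp; rfl
  obtain ⟨p, hp⟩ := h
  have hp' : ∀ x, p (Quot.mk _ (D.edge x)) = p (Quot.mk _ x) + 1 := by
    intro x
    have := D.forall_edge_pair (P := fun x y => p (Quot.mk _ x) + p (Quot.mk _ y) = 1)
      (fun _ _ h => by rwa [add_comm]) (fun e => congrFun hp e) x
    rw [← this, ← add_assoc, CharTwo.add_self_eq_zero, zero_add]
  exact ⟨fun x => p (Quot.mk _ x), hp', fun x => by rw [← hp', D.face_mk_edge]⟩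

/-- The vertex of the cube given by the oriented smoothing of every crossing. -/
def orientedVertex : D.Vertex := fun c => !D.pos c

/-- The circles of the oriented resolution can be coloured with two colours in such a way that
the two strands near each crossing have different colours. -/
theorem exists_colouring : ∃ col : D.Circle D.orientedVertex → Bool,
    ∀ c, col (D.circleOf _ (c, 0)) ≠ col (D.circleOf _ (c, 2)) := by
  obtain ⟨f, hf, hr⟩ := D.exists_checkerboard
  have h1 : ∀ c, f (c, 1) = f (c, 0) + 1 := fun c => hr (c, 0)
  have h2 : ∀ c, f (c, 2) = f (c, 0) := fun c => by
    rw [show f (c, 2) = f (c, 1) + 1 from hr (c, 1), h1, add_assoc, CharTwo.add_self_eq_zero,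
      add_zero]
  have h3 : ∀ c, f (c, 3) = f (c, 0) + 1 := fun c => by
    rw [show f (c, 3) = f (c, 2) + 1 from hr (c, 2), h2]
  have key : ∀ a : ZMod 2, decide (a + 1 = 1) = !decide (a = 1) := by decide
  have key' : ∀ a : ZMod 2, decide (a = 0) = !decide (a = 1) := by decide
  -- Orientation and face colour both flip along an edge and along an oriented smoothing, so their
  -- `xor` is constant on circles. Half-edges `0` and `2` have equal face colours but opposite
  -- orientations.
  let g : HalfEdge D.n → Bool := fun x => xor (isIncoming D.pos x) (decide (f x = 1))
  refine ⟨Sum.elim (Quot.lift g ?_) fun _ => false, fun c => ?_⟩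
  · rintro x y (rfl | rfl)
    · simp only [g, D.isIncoming_edge, hf, key]
      cases isIncoming D.pos x <;> cases decide (f x = 1) <;> rfl
    · obtain ⟨c, i⟩ := x
      fin_cases i <;> cases h : D.pos c <;>
        simp [g, smooth, orientedVertex, isIncoming, h, h1, h2, h3, key']
  · simp [circleOf, g, isIncoming, h2]

end LinkDiagram

/-! ### Sums over labelings, localized at two circles -/

section SumOverLabels

variable {S M : Type*} [Fintype S] [DecidableEq S]

/-- Group the labelings by their values off `A` and `B`; each class has four members. This turns a
local relation at a saddle into a global one. -/
theorem sum_eq_zero_of_sum_update_pair [AddCommMonoid M] {A B : S} (hAB : A ≠ B)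
    (f : (S → Bool) → M)
    (h : ∀ l, ∑ a, ∑ b, f (Function.update (Function.update l A a) B b) = 0) : ∑ l, f l = 0 := by
  rw [← Finset.sum_fiberwise (g := fun l => Function.update (Function.update l A false) B false)]
  refine Finset.sum_eq_zero fun l₀ _ => ?_
  by_cases h₀ : ∃ l, Function.update (Function.update l A false) B false = l₀
  · obtain ⟨l, rfl⟩ := h₀
    rw [← h l, ← Fintype.sum_prod_type']
    refine (Finset.sum_nbij' (fun x : Bool × Bool =>
      Function.update (Function.update l A x.1) B x.2) (fun m => (m A, m B)) ?_ ?_ ?_ ?_ ?_).symm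
    · rintro ⟨a, b⟩ -
      rw [Finset.mem_filter]
      refine ⟨Finset.mem_univ _, ?_⟩
      ext s
      simp only [Function.update_apply]
      split_ifs <;> rfl
    · simp
    · rintro ⟨a, b⟩ -
      simp [hAB]
    · intro m hm
      rw [Finset.mem_filter] at hm
      ext s
      have := congrFun hm.2 s
      simp only [Function.update_apply] at this ⊢
      split_ifs at this ⊢ with h1 h2
      · rw [h1]
      · rw [h2]
      · exact this.symm
    · simp
  · refine Finset.sum_eq_zero fun l hl => absurd ⟨l, (Finset.mem_filter.1 hl).2⟩ h₀

theorem prod_update_pair [CommMonoid M] {A B : S} (hAB : A ≠ B) (g : S → Bool → M) (l : S → Bool)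
    (a b : Bool) :
    ∏ C, g C (Function.update (Function.update l A a) B b C) =
      g A a * g B b * ∏ C ∈ (Finset.univ.erase A).erase B, g C (l C) := by
  rw [← Finset.mul_prod_erase _ _ (Finset.mem_univ A),
    ← Finset.mul_prod_erase _ _ (Finset.mem_erase.2 ⟨hAB.symm, Finset.mem_univ B⟩), ← mul_assoc]
  congr 1
  · simp [hAB]
  · refine Finset.prod_congr rfl fun C hC => ?_
    simp only [Finset.mem_erase] at hC
    simp [Function.update_of_ne hC.1, Function.update_of_ne hC.2.1]

end SumOverLabels

namespace LinkDiagram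

/-! ### How the circles change under a saddle -/

section Circles

variable (D : LinkDiagram)

theorem circleOf_edge (u : D.Vertex) (x : HalfEdge D.n) :
    D.circleOf u (D.edge x) = D.circleOf u x :=
  (congrArg Sum.inl (Quot.sound (Or.inl rfl) : Quot.mk _ x = Quot.mk _ (D.edge x))).symm

theorem circleOf_smooth (u : D.Vertex) (x : HalfEdge D.n) :
    D.circleOf u (D.smooth u x) = D.circleOf u x :=
  (congrArg Sum.inl (Quot.sound (Or.inr rfl) : Quot.mk _ x = Quot.mk _ (D.smooth u x))).symm

theorem edge_ne (x : HalfEdge D.n) : D.edge x ≠ x := by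
  intro h
  have := D.isIncoming_edge x
  rw [h] at this
  cases hx : isIncoming D.pos x <;> simp [hx] at this

theorem smooth_smooth (u : D.Vertex) (x : HalfEdge D.n) : D.smooth u (D.smooth u x) = x := by
  obtain ⟨c, i⟩ := x
  cases h : u c <;> fin_cases i <;> simp [smooth, h]

theorem smooth_ne (u : D.Vertex) (x : HalfEdge D.n) : D.smooth u x ≠ x := by
  obtain ⟨c, i⟩ := x
  cases h : u c <;> fin_cases i <;> simp [smooth, h]

theorem smooth_congr {u v : D.Vertex} {x : HalfEdge D.n} (h : u x.1 = v x.1) :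
    D.smooth u x = D.smooth v x := by
  simp [smooth, h]

theorem circleOf_eq_or (u : D.Vertex) (c : Fin D.n) (i : Fin 4) :
    D.circleOf u (c, i) = D.circleOf u (c, 0) ∨ D.circleOf u (c, i) = D.circleOf u (c, 2) := by
  have h0 := D.circleOf_smooth u (c, 0)
  have h2 := D.circleOf_smooth u (c, 2)
  cases h : u c <;> simp only [smooth, h] at h0 h2 <;> fin_cases i <;>
    first | exact Or.inl rfl | exact Or.inr rfl | exact Or.inl h0 | exact Or.inr h2

/-- A saddle at `c` only affects the circles passing through `c`. -/
theorem circleOf_eq_or_of_circleOf_eq_or {u v : D.Vertex} {c : Fin D.n}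
    (huv : ∀ c', c' ≠ c → u c' = v c') {x : HalfEdge D.n}
    (hx : D.circleOf u x = D.circleOf u (c, 0) ∨ D.circleOf u x = D.circleOf u (c, 2)) :
    D.circleOf v x = D.circleOf v (c, 0) ∨ D.circleOf v x = D.circleOf v (c, 2) := by
  let P : HalfEdge D.n → Prop := fun x =>
    D.circleOf v x = D.circleOf v (c, 0) ∨ D.circleOf v x = D.circleOf v (c, 2)
  -- `P` respects the relation generating the circles of `u`: away from `c` the smoothings agree,
  -- and at `c` all four half-edges satisfy `P`. The value on crossingless loops is immaterial.
  let Q : D.Circle u → Prop := Sum.elim (Quot.lift P (by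
    rintro x y (rfl | rfl)
    · simp only [P, D.circleOf_edge]
    · by_cases hc : x.1 = c
      · obtain ⟨c, i⟩ := x
        subst hc
        exact propext ⟨fun _ => D.circleOf_eq_or v _ _, fun _ => D.circleOf_eq_or v _ _⟩
      · simp only [P, D.smooth_congr (huv _ hc), D.circleOf_smooth])) fun _ => True
  have hQ : ∀ x, Q (D.circleOf u x) = P x := fun x => rfl
  change P x
  rw [← hQ]
  rcases hx with h | h <;> rw [h, hQ]
  · exact Or.inl rfl
  · exact Or.inr rfl

/-- If the two strands of the `1`-smoothing at `c` lie on different circles, then the strands of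
the `0`-smoothing at `c` lie on the same circle. -/
theorem circleOf_eq_of_circleOf_ne {u v : D.Vertex} {c : Fin D.n}
    (huv : ∀ c', c' ≠ c → u c' = v c') (hu : u c = true) (hv : v c = false)
    (hne : D.circleOf u (c, 0) ≠ D.circleOf u (c, 2)) :
    D.circleOf v (c, 0) = D.circleOf v (c, 2) := by
  classical
  by_contra hne'
  -- Parity argument: `edge` pairs off `T` without fixed points. If both resolutions separate `0`
  -- from `2`, then `(c, 0)` is the only member of `T` at `c`, and the smoothing, common to `u` and
  -- `v` elsewhere, pairs off the rest. So `T` would be both even and odd.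
  let T : Finset (HalfEdge D.n) := Finset.univ.filter fun x =>
    D.circleOf u x = D.circleOf u (c, 0) ∧ D.circleOf v x = D.circleOf v (c, 0)
  have hT : ∀ {x}, x ∈ T ↔ D.circleOf u x = D.circleOf u (c, 0) ∧
    D.circleOf v x = D.circleOf v (c, 0) := by simp [T]
  have h0 : (c, 0) ∈ T := hT.2 ⟨rfl, rfl⟩
  have hc : ∀ x ∈ T.erase (c, 0), x.1 ≠ c := by
    rintro ⟨c', i⟩ hx rfl
    rw [Finset.mem_erase, hT] at hx
    have hu2 := D.circleOf_smooth u (c', 2)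
    have hv2 := D.circleOf_smooth v (c', 2)
    simp only [smooth, hu, hv] at hu2 hv2
    fin_cases i
    · exact hx.1 rfl
    · exact hne (hx.2.1.symm.trans hu2)
    · exact hne hx.2.1.symm
    · exact hne' (hx.2.2.symm.trans hv2)
  have h1 : ∑ x ∈ T, (1 : ZMod 2) = 0 :=
    Finset.sum_involution (fun x _ => D.edge x) (fun _ _ => by decide)
      (fun x _ _ => D.edge_ne x) (fun x hx => by
        rw [hT] at hx ⊢
        rwa [D.circleOf_edge, D.circleOf_edge]) (fun x _ => D.edge_edge x)
  have h2 : ∑ x ∈ T.erase (c, 0), (1 : ZMod 2) = 0 :=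
    Finset.sum_involution (fun x _ => D.smooth u x) (fun _ _ => by decide)
      (fun x _ _ => D.smooth_ne u x) (fun x hx => by
        have hxc := hc x hx
        rw [Finset.mem_erase, hT] at hx ⊢
        refine ⟨fun h => hxc (congrArg Prod.fst h), ?_, ?_⟩
        · rw [D.circleOf_smooth, hx.2.1]
        · rw [D.smooth_congr (huv _ hxc), D.circleOf_smooth, hx.2.2])
      (fun x _ => D.smooth_smooth u x)
  rw [← Finset.add_sum_erase _ _ h0, h2] at h1
  exact absurd h1 (by decide)

end Circles

/-! ### The canonical cycle and the nonvanishing of homology modulo torsion -/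

variable (F : Type*) [Field F] (D : LinkDiagram)

theorem diff_apply (z : CKh F D) (H : D.Gen) : diff F D z H = ∑ G, diffMatrix F D H G * z G := rfl

/-- The roots `U` and `V` of the polynomial defining the Frobenius algebra. -/
def root (k : Bool) : GroundRing F := if k then varV F else varU F

/-- The coordinates of `X - U` and `X - V` in the basis `1, X`. -/
def cycleWeight (k a : Bool) : GroundRing F := if a then 1 else -root F k

/-- The values at `1` and `X` of the algebra homomorphism that sends `X` to the root other than
the given one. -/
def dualWeight (k a : Bool) : GroundRing F := if a then root F !k else 1

theorem root_sub_root_ne_zero (k : Bool) : root F (!k) - root F k ≠ 0 := by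
  have h : varU F ≠ varV F := fun h => by simpa using MvPolynomial.X_injective h
  cases k <;> simp only [root, sub_ne_zero] <;> simp [h, h.symm]

/-- This is `(X - U)(X - V) = 0` in `A`. -/
theorem sum_mulCoeff (k a : Bool) :
    ∑ x, ∑ y, cycleWeight F k x * cycleWeight F (!k) y * mulCoeff F x y a = 0 := by
  cases k <;> cases a <;> simp [cycleWeight, root, mulCoeff]
  all_goals ring

/-- Sending the two tensor factors to different roots kills `Δ(1)` and `Δ(X)`, as `U + V - (U + V) =
0` and `UV - UV = 0`. -/
theorem sum_comulCoeff (k a : Bool) :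
    ∑ x, ∑ y, dualWeight F k x * dualWeight F (!k) y * comulCoeff F a x y = 0 := by
  cases k <;> cases a <;> simp [dualWeight, root, comulCoeff]
  all_goals ring

-- The factor `r` records whether the labels of the circles away from `c` match; this does not
-- involve `a` and `b`.
open Classical in
theorem saddleCoeff_merge {c : Fin D.n} {u : D.Vertex} {l : D.Circle u → Bool} (H : D.Gen)
    (hne : D.circleOf u (c, 0) ≠ D.circleOf u (c, 2)) :
    ∃ r, ∀ a b, saddleCoeff F D c ⟨u, Function.update
      (Function.update l (D.circleOf u (c, 0)) a) (D.circleOf u (c, 2)) b⟩ H =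
        r * mulCoeff F a b (H.label (D.circleOf H.u (c, 0))) := by
  refine ⟨if (∀ x : HalfEdge D.n, D.circleOf u x ≠ D.circleOf u (c, 0) →
        D.circleOf u x ≠ D.circleOf u (c, 2) →
        H.label (D.circleOf H.u x) = l (D.circleOf u x)) ∧
      (∀ i : Fin D.loops, H.label (Sum.inr i) = l (Sum.inr i)) then 1 else 0, fun a b => ?_⟩
  rw [saddleCoeff, ite_mul, one_mul, zero_mul]
  congr 1
  · refine propext (and_congr (forall_congr' fun x => forall_congr' fun h0 =>
      forall_congr' fun h2 => ?_) (forall_congr' fun i => ?_))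
    · simp [h0, h2]
    · simp [circleOf]
  · simp [hne]

-- The counterpart for a saddle ending at `u`. Circles missing `c` before the saddle still miss it
-- afterwards, so the matching condition does not involve `a` and `b`.
open Classical in
theorem saddleCoeff_split {c : Fin D.n} {u : D.Vertex} {l : D.Circle u → Bool} (G : D.Gen)
    (hu : u = Function.update G.u c true) (hc : G.u c = false)
    (hne : D.circleOf u (c, 0) ≠ D.circleOf u (c, 2)) :
    ∃ r, ∀ a b, saddleCoeff F D c G ⟨u, Function.update
      (Function.update l (D.circleOf u (c, 0)) a) (D.circleOf u (c, 2)) b⟩ =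
        r * comulCoeff F (G.label (D.circleOf G.u (c, 0))) a b := by
  have huv : ∀ c', c' ≠ c → u c' = G.u c' := fun c' h => by rw [hu, Function.update_of_ne h]
  have hu1 : u c = true := by rw [hu, Function.update_self]
  refine ⟨if (∀ x : HalfEdge D.n, D.circleOf G.u x ≠ D.circleOf G.u (c, 0) →
        D.circleOf G.u x ≠ D.circleOf G.u (c, 2) →
        l (D.circleOf u x) = G.label (D.circleOf G.u x)) ∧
      (∀ i : Fin D.loops, l (Sum.inr i) = G.label (Sum.inr i)) then 1 else 0, fun a b => ?_⟩
  rw [saddleCoeff, ite_mul, one_mul, zero_mul]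
  congr 1
  · refine propext (and_congr (forall_congr' fun x => forall_congr' fun h0 =>
      forall_congr' fun h2 => ?_) (forall_congr' fun i => ?_))
    · have h := mt (D.circleOf_eq_or_of_circleOf_eq_or huv (x := x)) (not_or.2 ⟨h0, h2⟩)
      rw [not_or] at h
      simp [h.1, h.2]
    · simp [circleOf]
  · rw [if_neg (not_not.2 (D.circleOf_eq_of_circleOf_ne huv hu1 hc hne))]
    simp [hne]

section Canonical

variable {F D} {u : D.Vertex} (col : D.Circle u → Bool)

open Classical in
/-- The chain given by the tensor product of the elements `X - U` and `X - V`, according to the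
colours of the circles of `D_u`. -/
def canonicalChain (F : Type*) [Field F] : CKh F D :=
  ∑ l : D.Circle u → Bool, Pi.single ⟨u, l⟩ (∏ C, cycleWeight F (col C) (l C))

open Classical in
/-- The functional given by the tensor product of the homomorphisms `X ↦ V` and `X ↦ U`,
according to the colours of the circles of `D_u`. -/
def canonicalDual (z : CKh F D) : GroundRing F :=
  ∑ l : D.Circle u → Bool, (∏ C, dualWeight F (col C) (l C)) * z ⟨u, l⟩

theorem canonicalDual_smul (r : GroundRing F) (z : CKh F D) :
    canonicalDual col (r • z) = r * canonicalDual col z := by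
  simp only [canonicalDual, Finset.mul_sum, Pi.smul_apply, smul_eq_mul, mul_left_comm]

/-- The pairing factors over the circles, and each factor is `V - U` or `U - V`. -/
theorem canonicalDual_canonicalChain_ne_zero :
    canonicalDual col (canonicalChain col F) ≠ 0 := by
  classical
  have h : ∀ l, canonicalChain col F ⟨u, l⟩ = ∏ C, cycleWeight F (col C) (l C) := by
    intro l
    rw [canonicalChain, Finset.sum_apply, Finset.sum_eq_single l]
    · simp
    · intro m _ hm
      exact Pi.single_eq_of_ne (fun h => hm (by simpa using h.symm)) _
    · simp
  simp only [canonicalDual, h, ← Finset.prod_mul_distrib]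
  rw [← Fintype.prod_sum (fun C a => dualWeight F (col C) a * cycleWeight F (col C) a)]
  refine Finset.prod_ne_zero_iff.2 fun C _ => ?_
  simpa [dualWeight, cycleWeight, sub_eq_add_neg] using root_sub_root_ne_zero F (col C)

variable {col}

/-- By the colouring, every saddle leaving `u` merges two circles of different colours, so
`sum_mulCoeff` applies. -/
theorem diff_canonicalChain
    (hcol : ∀ c, col (D.circleOf u (c, 0)) ≠ col (D.circleOf u (c, 2))) :
    diff F D (canonicalChain col F) = 0 := by
  classical
  ext1 H
  have h : diff F D (canonicalChain col F) H =
      ∑ l : D.Circle u → Bool, (∏ C, cycleWeight F (col C) (l C)) * diffMatrix F D H ⟨u, l⟩ := by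
    rw [canonicalChain, map_sum, Finset.sum_apply]
    refine Finset.sum_congr rfl fun l _ => ?_
    rw [diff_apply, Finset.sum_eq_single ⟨u, l⟩]
    · rw [Pi.single_eq_same, mul_comm]
    · intro G _ hG
      rw [Pi.single_eq_of_ne hG, mul_zero]
    · simp
  rw [h]
  simp only [diffMatrix, Finset.mul_sum]
  rw [Finset.sum_comm]
  refine Finset.sum_eq_zero fun c _ => ?_
  by_cases hc : u c = false ∧ H.u = Function.update u c true
  · have hne : D.circleOf u (c, 0) ≠ D.circleOf u (c, 2) := fun h => hcol c (congrArg col h)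
    simp only [hc, and_self, if_true]
    refine sum_eq_zero_of_sum_update_pair hne _ fun l => ?_
    obtain ⟨r, hr⟩ := saddleCoeff_merge F D (l := l) H hne
    simp only [hr, prod_update_pair hne fun C => cycleWeight F (col C)]
    have key := sum_mulCoeff F (col (D.circleOf u (c, 0))) (H.label (D.circleOf H.u (c, 0)))
    rw [← Bool.eq_not.2 (hcol c).symm] at key
    rw [← mul_zero (r * edgeSign F D u c *
      ∏ C ∈ (Finset.univ.erase (D.circleOf u (c, 0))).erase (D.circleOf u (c, 2)),
        cycleWeight F (col C) (l C)), ← key]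
    simp only [Finset.mul_sum]
    refine Finset.sum_congr rfl fun a _ => Finset.sum_congr rfl fun b _ => by ring
  · simp [hc]

/-- Dually, every saddle arriving at `u` splits a circle into two of different colours, so
`sum_comulCoeff` applies. -/
theorem canonicalDual_diff
    (hcol : ∀ c, col (D.circleOf u (c, 0)) ≠ col (D.circleOf u (c, 2)))
    (z : CKh F D) : canonicalDual col (diff F D z) = 0 := by
  classical
  simp only [canonicalDual, diff_apply, Finset.mul_sum, ← mul_assoc]
  rw [Finset.sum_comm]
  refine Finset.sum_eq_zero fun G _ => ?_
  rw [← Finset.sum_mul]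
  refine mul_eq_zero_of_left ?_ _
  simp only [diffMatrix, Finset.mul_sum]
  rw [Finset.sum_comm]
  refine Finset.sum_eq_zero fun c _ => ?_
  by_cases hc : G.u c = false ∧ u = Function.update G.u c true
  · have hne : D.circleOf u (c, 0) ≠ D.circleOf u (c, 2) := fun h => hcol c (congrArg col h)
    simp only [if_pos hc]
    refine sum_eq_zero_of_sum_update_pair hne _ fun l => ?_
    obtain ⟨r, hr⟩ := saddleCoeff_split F D (l := l) G hc.2 hc.1 hne
    simp only [hr, prod_update_pair hne fun C => dualWeight F (col C)]
    have key := sum_comulCoeff F (col (D.circleOf u (c, 0))) (G.label (D.circleOf G.u (c, 0)))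
    rw [← Bool.eq_not.2 (hcol c).symm] at key
    rw [← mul_zero (r * edgeSign F D G.u c *
      ∏ C ∈ (Finset.univ.erase (D.circleOf u (c, 0))).erase (D.circleOf u (c, 2)),
        dualWeight F (col C) (l C)), ← key]
    simp only [Finset.mul_sum]
    refine Finset.sum_congr rfl fun a _ => Finset.sum_congr rfl fun b _ => by ring
  · simp [hc]

end Canonical

/-- The class of a cycle in the homology modulo torsion. -/
def freeClass (z : Cycles F D) : KhFree F D :=
  (Submodule.torsion (GroundRing F) (Kh F D)).mkQ ((Boundaries F D).mkQ z)

/-- If `r` times the canonical cycle were a boundary, the dual functional would give `r` times a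
nonzero polynomial equal to zero in a domain. -/
theorem exists_freeClass_ne_zero : ∃ z : Cycles F D, freeClass F D z ≠ 0 := by
  obtain ⟨col, hcol⟩ := D.exists_colouring
  refine ⟨⟨canonicalChain col F, diff_canonicalChain hcol⟩, fun h => ?_⟩
  rw [freeClass, Submodule.mkQ_apply, Submodule.Quotient.mk_eq_zero,
    Submodule.mem_torsion_iff] at h
  obtain ⟨r, hr⟩ := h
  change (r : GroundRing F) • (Boundaries F D).mkQ _ = 0 at hr
  rw [← LinearMap.map_smul, Submodule.mkQ_apply, Submodule.Quotient.mk_eq_zero] at hr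
  obtain ⟨y, hy⟩ : _ ∈ LinearMap.range (diff F D) := hr
  have := canonicalDual_diff hcol y
  rw [hy] at this
  change canonicalDual col ((r : GroundRing F) • canonicalChain col F) = 0 at this
  rw [canonicalDual_smul] at this
  exact mul_ne_zero (nonZeroDivisors.ne_zero r.2) (canonicalDual_canonicalChain_ne_zero col) this

end LinkDiagram

/-! ### Maxima of minima of finitely many lines -/

section PiecewiseLinear

/-- The line with the slope and the intercept given by a pair of real numbers. -/
def line (p : ℝ × ℝ) (x : ℝ) : ℝ := p.1 * x + p.2

theorem continuous_line (p : ℝ × ℝ) : Continuous (line p) := by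
  unfold line; fun_prop

/-- The abscissa of the intersection of two lines. -/
def crossing (p q : ℝ × ℝ) : ℝ := (q.2 - p.2) / (p.1 - q.1)

/-- The difference of two lines changes sign only at their crossing. For equal slopes `crossing` has
the default value `0`, which at worst adds a spurious breakpoint. -/
theorem line_le_or_le {p q : ℝ × ℝ} {a b : ℝ} (h : crossing p q ∉ Ioo a b) :
    (∀ x ∈ Icc a b, line p x ≤ line q x) ∨ ∀ x ∈ Icc a b, line q x ≤ line p x := by
  rcases eq_or_ne p.1 q.1 with h1 | h1
  · rcases le_total p.2 q.2 with h2 | h2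
    · exact Or.inl fun x _ => by simpa [line, h1] using h2
    · exact Or.inr fun x _ => by simpa [line, h1] using h2
  · have h0 : p.1 - q.1 ≠ 0 := sub_ne_zero.2 h1
    have key : ∀ x, line p x - line q x = (p.1 - q.1) * (x - crossing p q) := by
      intro x
      rw [crossing, mul_sub, mul_div_cancel₀ _ h0, line, line]
      ring
    have hx : (∀ x ∈ Icc a b, 0 ≤ x - crossing p q) ∨ ∀ x ∈ Icc a b, x - crossing p q ≤ 0 := by
      by_cases ha : a < crossing p q
      · refine Or.inr fun x hx => ?_
        have : b ≤ crossing p q := not_lt.1 fun hb => h ⟨ha, hb⟩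
        linarith [hx.2]
      · exact Or.inl fun x hx => by linarith [hx.1]
    rcases hx with hx | hx <;> rcases le_total 0 (p.1 - q.1) with hs | hs
    · exact Or.inr fun x h => by nlinarith [key x, mul_nonneg hs (hx x h)]
    · exact Or.inl fun x h => by nlinarith [key x, mul_nonpos_of_nonpos_of_nonneg hs (hx x h)]
    · exact Or.inl fun x h => by nlinarith [key x, mul_nonpos_of_nonneg_of_nonpos hs (hx x h)]
    · exact Or.inr fun x h => by nlinarith [key x, mul_nonneg_of_nonpos_of_nonpos hs (hx x h)]

/-- A function is affine away from a set of breakpoints if it is affine on every interval whose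
interior contains no breakpoint. -/
def IsAffineOffBreakpoints (P : Set ℝ) (f : ℝ → ℝ) : Prop :=
  ∀ a b, Disjoint (Ioo a b) P → ∃ p, EqOn f (line p) (Icc a b)

/-- Lattice polynomials in finitely many lines are piecewise affine. -/
theorem isAffineOffBreakpoints_sup'_inf' {κ ι : Type*} {s : Finset κ} (hs : s.Nonempty)
    (T : κ → Finset ι) (hT : ∀ k, (T k).Nonempty) (p : ι → ℝ × ℝ) :
    IsAffineOffBreakpoints
      {x | ∃ k ∈ s, ∃ i ∈ T k, ∃ l ∈ s, ∃ j ∈ T l, x = crossing (p i) (p j)}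
      (s.sup' hs fun k => (T k).inf' (hT k) fun i => line (p i)) := by
  intro a b hab
  let Λ : Set (ℝ × ℝ) := {q | ∃ k ∈ s, ∃ i ∈ T k, q = p i}
  have hΛ : ∀ q ∈ Λ, ∀ r ∈ Λ, crossing q r ∉ Ioo a b := by
    rintro _ ⟨k, hk, i, hi, rfl⟩ _ ⟨l, hl, j, hj, rfl⟩ hx
    exact Set.disjoint_left.1 hab hx ⟨k, hk, i, hi, l, hl, j, hj, rfl⟩
  -- The induction must remember that the affine piece is one of the given lines, since only these
  -- are known to be comparable on the interval.
  suffices h : ∃ q ∈ Λ, EqOn (s.sup' hs fun k => (T k).inf' (hT k) fun i => line (p i))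
      (line q) (Icc a b) from h.imp fun q hq => hq.2
  refine Finset.sup'_induction (p := fun f : ℝ → ℝ => ∃ q ∈ Λ, EqOn f (line q) (Icc a b)) hs _
    ?_ fun k hk => Finset.inf'_induction
      (p := fun f : ℝ → ℝ => ∃ q ∈ Λ, EqOn f (line q) (Icc a b)) (hT k) _ ?_ fun i hi =>
        ⟨p i, ⟨k, hk, i, hi, rfl⟩, fun _ _ => rfl⟩
  · rintro f ⟨q, hq, hf⟩ g ⟨r, hr, hg⟩
    rcases line_le_or_le (hΛ q hq r hr) with h | h
    · exact ⟨r, hr, fun x hx => by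
        rw [Pi.sup_apply, hf hx, hg hx]; exact sup_eq_right.2 (h x hx)⟩
    · exact ⟨q, hq, fun x hx => by
        rw [Pi.sup_apply, hf hx, hg hx]; exact sup_eq_left.2 (h x hx)⟩
  · rintro f ⟨q, hq, hf⟩ g ⟨r, hr, hg⟩
    rcases line_le_or_le (hΛ q hq r hr) with h | h
    · exact ⟨q, hq, fun x hx => by
        rw [Pi.inf_apply, hf hx, hg hx]; exact inf_eq_left.2 (h x hx)⟩
    · exact ⟨r, hr, fun x hx => by
        rw [Pi.inf_apply, hf hx, hg hx]; exact inf_eq_right.2 (h x hx)⟩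

theorem finite_crossings {κ ι : Type*} (s : Finset κ) (T : κ → Finset ι) (p : ι → ℝ × ℝ) :
    {x | ∃ k ∈ s, ∃ i ∈ T k, ∃ l ∈ s, ∃ j ∈ T l, x = crossing (p i) (p j)}.Finite := by
  classical
  refine (((s.biUnion T) ×ˢ (s.biUnion T)).image
    fun x => crossing (p x.1) (p x.2)).finite_toSet.subset ?_
  rintro _ ⟨k, hk, i, hi, l, hl, j, hj, rfl⟩
  refine Finset.mem_coe.2 (Finset.mem_image.2 ⟨(i, j), ?_, rfl⟩)
  exact Finset.mem_product.2 ⟨Finset.mem_biUnion.2 ⟨k, hk, hi⟩, Finset.mem_biUnion.2 ⟨l, hl, hj⟩⟩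

theorem IsAffineOffBreakpoints.sub_const {P : Set ℝ} {f : ℝ → ℝ} (h : IsAffineOffBreakpoints P f)
    (c : ℝ) : IsAffineOffBreakpoints P fun x => f x - c := fun a b hab => by
  obtain ⟨p, hp⟩ := h a b hab
  refine ⟨(p.1, p.2 - c), fun x hx => ?_⟩
  change f x - c = _
  rw [hp hx, line, line]
  ring

theorem IsAffineOffBreakpoints.isPiecewiseLinearOn {P : Set ℝ} (hP : P.Finite) {f : ℝ → ℝ}
    (h : IsAffineOffBreakpoints P f) {a b : ℝ} (hab : a ≤ b) : IsPiecewiseLinearOn f a b := by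
  classical
  let Q : Finset ℝ := insert a (insert b (hP.toFinset.filter fun x => x ∈ Ioo a b))
  have hQ : ∀ x ∈ Q, a ≤ x ∧ x ≤ b := by
    intro x hx
    simp only [Q, Finset.mem_insert, Finset.mem_filter] at hx
    rcases hx with rfl | rfl | hx
    · exact ⟨le_rfl, hab⟩
    · exact ⟨hab, le_rfl⟩
    · exact ⟨hx.2.1.le, hx.2.2.le⟩
  have ha : a ∈ Q := Finset.mem_insert_self _ _
  have hb : b ∈ Q := Finset.mem_insert_of_mem (Finset.mem_insert_self _ _)
  obtain ⟨N, hN⟩ : ∃ N, Q.card = N + 1 :=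
    ⟨Q.card - 1, (Nat.succ_pred_eq_of_pos (Finset.card_pos.2 ⟨a, ha⟩)).symm⟩
  let e := Q.orderEmbOfFin hN
  have he : ∀ x ∈ Q, ∃ i, e i = x := fun x hx => by
    have : x ∈ Set.range e := by rw [Finset.range_orderEmbOfFin]; exact hx
    exact this
  have hmem : ∀ i, e i ∈ Q := Q.orderEmbOfFin_mem hN
  -- The subdivision lists `Q` in increasing order. `Fin.ofNat` wraps around modulo `N + 1`, but
  -- only indices up to `N` are used.
  refine ⟨N, fun i => e (Fin.ofNat (N + 1) i), ?_, ?_, fun i hi => ?_, fun i hi => ?_⟩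
  · obtain ⟨i, hi⟩ := he a ha
    refine le_antisymm ?_ (hQ _ (hmem _)).1
    rw [← hi]
    exact e.monotone (Fin.zero_le i)
  · obtain ⟨i, hi⟩ := he b hb
    refine le_antisymm (hQ _ (hmem _)).2 ?_
    rw [← hi]
    refine e.monotone (Fin.le_def.2 ?_)
    simp only [Fin.ofNat, Nat.mod_eq_of_lt (Nat.lt_succ_self N)]
    exact Nat.lt_succ_iff.1 i.2
  · refine e.strictMono (Fin.lt_def.2 ?_)
    simp only [Fin.ofNat]
    rw [Nat.mod_eq_of_lt (by omega), Nat.mod_eq_of_lt (by omega)]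
    exact Nat.lt_succ_self i
  · obtain ⟨p, hp⟩ := h (e (Fin.ofNat (N + 1) i)) (e (Fin.ofNat (N + 1) (i + 1)))
      (Set.disjoint_left.2 fun x hx hxP => by
        have hxQ : x ∈ Q := by
          refine Finset.mem_insert_of_mem (Finset.mem_insert_of_mem (Finset.mem_filter.2
            ⟨hP.mem_toFinset.2 hxP, (hQ _ (hmem _)).1.trans_lt hx.1,
              hx.2.trans_le (hQ _ (hmem _)).2⟩))
        obtain ⟨j, rfl⟩ := he x hxQ
        have h1 := Fin.lt_def.1 (e.lt_iff_lt.1 hx.1)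
        have h2 := Fin.lt_def.1 (e.lt_iff_lt.1 hx.2)
        simp only [Fin.ofNat] at h1 h2
        rw [Nat.mod_eq_of_lt (by omega)] at h1 h2
        omega)
    exact ⟨p.1, p.2, fun x hx => hp hx⟩

theorem IsAffineOffBreakpoints.differentiableAt {P : Set ℝ} (hP : P.Finite) {f : ℝ → ℝ}
    (h : IsAffineOffBreakpoints P f) {x : ℝ} (hx : x ∉ P) : DifferentiableAt ℝ f x := by
  obtain ⟨ε, hε, hball⟩ := Metric.isOpen_iff.1 hP.isClosed.isOpen_compl x hx
  obtain ⟨p, hp⟩ := h (x - ε) (x + ε)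
    (Set.disjoint_left.2 fun y hy => hball (by rwa [Real.ball_eq_Ioo]))
  have hd : DifferentiableAt ℝ (line p) x := by unfold line; fun_prop
  exact hd.congr_of_eventuallyEq (Filter.eventuallyEq_of_mem
    (Icc_mem_nhds (by linarith) (by linarith)) hp)

theorem continuous_sup'_inf'_line {κ ι : Type*} {s : Finset κ} (hs : s.Nonempty)
    (T : κ → Finset ι) (hT : ∀ k, (T k).Nonempty) (p : ι → ℝ × ℝ) :
    Continuous (s.sup' hs fun k => (T k).inf' (hT k) fun i => line (p i)) :=
  Continuous.finset_sup' hs fun k _ => Continuous.finset_inf' (hT k) fun i _ =>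
    continuous_line (p i)

end PiecewiseLinear

/-! ### Finitely many finite sets suffice -/

section WellQuasiOrder

/-- In a family of finite subsets of a well-quasi-order there are finitely many members such that
each member dominates one of them. -/
theorem exists_finset_forall_dominates {α κ : Type*} {r : α → α → Prop}
    [IsPreorder α r] (hr : WellQuasiOrdered r) (T : κ → Finset α) :
    ∃ s : Finset κ, ∀ k, ∃ j ∈ s, ∀ x ∈ T j, ∃ y ∈ T k, r x y := by
  by_contra! hcon
  -- If no finite subfamily suffices, there is an infinite bad sequence; Higman's lemma, applied to
  -- the sets listed in any order, excludes it.
  obtain ⟨f, -, hf⟩ := exists_seq_of_forall_finset_exists (fun _ : κ => True)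
    (fun j k => ∃ x ∈ T j, ∀ y ∈ T k, ¬ r x y) fun s _ => (hcon s).imp fun k hk => ⟨trivial, hk⟩
  have hlist := PartiallyWellOrderedOn.partiallyWellOrderedOn_sublistForall₂ r
    (partiallyWellOrderedOn_of_wellQuasiOrdered hr univ)
  obtain ⟨m, n, hmn, hle⟩ := hlist fun n => ⟨(T (f n)).toList, fun _ _ => mem_univ _⟩
  change List.SublistForall₂ r (T (f m)).toList (T (f n)).toList at hle
  obtain ⟨x, hx, hxy⟩ := hf m n hmn
  obtain ⟨l, hl, hsub⟩ := List.sublistForall₂_iff.1 hle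
  obtain ⟨y, hy, hle⟩ : ∃ y ∈ l, r x y := by
    have hx' := Finset.mem_toList.2 hx
    clear hsub hle
    generalize (T (f m)).toList = L at hl hx'
    induction hl with
    | nil => simp at hx'
    | cons h _ ih =>
      rcases List.mem_cons.1 hx' with rfl | hx'
      · exact ⟨_, List.mem_cons_self, h⟩
      · obtain ⟨y, hy, h⟩ := ih hx'
        exact ⟨y, List.mem_cons_of_mem _ hy, h⟩
  exact hxy y (Finset.mem_toList.1 (hsub.subset hy)) hle

end WellQuasiOrder

/-! ### The filtration and the reduction to finitely many cycles -/

namespace LinkDiagram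

section Filtration

variable {F : Type*} [Field F] {D : LinkDiagram}

open Classical in
/-- The elements `U ^ m * V ^ k * G` of the distinguished `F`-basis that occur in a chain. -/
def basisSupport (z : CKh F D) : Finset (D.Gen × (Fin 2 →₀ ℕ)) :=
  Finset.univ.biUnion fun G => (z G).support.image (Prod.mk G)

theorem mem_basisSupport {z : CKh F D} {G : D.Gen} {s : Fin 2 →₀ ℕ} :
    (G, s) ∈ basisSupport z ↔ MvPolynomial.coeff s (z G) ≠ 0 := by
  simp [basisSupport]

theorem basisSupport_nonempty {z : CKh F D} (hz : z ≠ 0) : (basisSupport z).Nonempty := by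
  obtain ⟨G, hG⟩ := Function.ne_iff.1 hz
  obtain ⟨s, hs⟩ := MvPolynomial.ne_zero_iff.1 hG
  exact ⟨(G, s), mem_basisSupport.2 hs⟩

/-- The grading of a basis element as an affine function of `t`. -/
def gradingLine (x : D.Gen × (Fin 2 →₀ ℕ)) : ℝ × ℝ :=
  (x.2 1 - x.2 0, D.grq x.1 - 2 * x.2 1)

theorem line_gradingLine (x : D.Gen × (Fin 2 →₀ ℕ)) (t : ℝ) :
    line (gradingLine x) t = grt D t (x.2 0) (x.2 1) x.1 := by
  simp only [line, gradingLine, grt]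
  ring

/-- The filtration is spanned by part of an `F`-basis, so membership can be tested on the basis
elements that occur. -/
theorem mem_filCKh_iff {t a : ℝ} {z : CKh F D} :
    z ∈ filCKh F D t a ↔ ∀ x ∈ basisSupport z, a ≤ line (gradingLine x) t := by
  classical
  constructor
  · intro hz
    rintro ⟨H, s⟩ hs
    rw [mem_basisSupport] at hs
    induction hz using Submodule.span_induction generalizing H s with
    | mem z hz =>
      obtain ⟨m, k, G, hG, rfl⟩ := hz
      by_cases hH : H = G
      · subst hH
        have hmon := MvPolynomial.monomial_fin_two
          (Finsupp.equivFunOnFinite.symm ![m, k]) (1 : F)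
        simp only [Finsupp.equivFunOnFinite_symm_apply_apply, Matrix.cons_val_zero,
          Matrix.cons_val_one, map_one, one_mul] at hmon
        rw [Pi.single_eq_same, ← hmon, MvPolynomial.coeff_monomial] at hs
        obtain rfl := (ite_ne_right_iff.1 hs).1
        rw [line_gradingLine]
        simpa using hG
      · rw [Pi.single_eq_of_ne hH] at hs
        exact absurd (MvPolynomial.coeff_zero s) hs
    | zero => exact absurd (MvPolynomial.coeff_zero s) hs
    | add x y _ _ hx hy =>
      rw [Pi.add_apply, MvPolynomial.coeff_add] at hs
      by_cases h : MvPolynomial.coeff s (x H) = 0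
      · exact hy H s fun h' => hs (by rw [h, h', add_zero])
      · exact hx H s h
    | smul c x _ hx =>
      rw [Pi.smul_apply, MvPolynomial.coeff_smul] at hs
      exact hx H s fun h => hs (by rw [h, smul_zero])
  · intro h
    rw [← Finset.univ_sum_single z]
    refine Submodule.sum_mem _ fun G _ => ?_
    rw [(z G).as_sum, ← LinearMap.single_apply (R := F), map_sum]
    refine Submodule.sum_mem _ fun s hs => ?_
    rw [MvPolynomial.monomial_fin_two, mul_assoc, ← MvPolynomial.smul_eq_C_mul, map_smul]
    refine Submodule.smul_mem _ _ (Submodule.subset_span ⟨s 0, s 1, G, ?_, rfl⟩)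
    rw [← line_gradingLine (G, s)]
    exact h _ (mem_basisSupport.2 (MvPolynomial.mem_support_iff.1 hs))

theorem mem_filKhFree_iff {t a : ℝ} {η : KhFree F D} :
    η ∈ filKhFree F D t a ↔ ∃ z : Cycles F D, (z : CKh F D) ∈ filCKh F D t a ∧
      freeClass F D z = η := by
  constructor
  · rintro ⟨_, ⟨z, hz, rfl⟩, rfl⟩
    exact ⟨z, hz, rfl⟩
  · rintro ⟨z, hz, rfl⟩
    exact ⟨_, ⟨z, hz, rfl⟩, rfl⟩

/-- Divisibility of basis elements by monomials in `U` and `V`. -/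
def BasisDvd (x y : D.Gen × (Fin 2 →₀ ℕ)) : Prop := x.1 = y.1 ∧ x.2 ≤ y.2

instance : IsPreorder (D.Gen × (Fin 2 →₀ ℕ)) BasisDvd where
  refl _ := ⟨rfl, le_rfl⟩
  trans _ _ _ h h' := ⟨h.1.trans h'.1, h.2.trans h'.2⟩

/-- Dickson's lemma for the exponents, together with the finiteness of the set of Khovanov
generators. -/
theorem wellQuasiOrdered_basisDvd : WellQuasiOrdered (BasisDvd (D := D)) :=
  (Finite.wellQuasiOrdered (· = ·)).prod wellQuasiOrdered_le

/-- The weights `t` and `2 - t` of `U` and `V` are nonnegative exactly on `[0, 2]`. -/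
theorem BasisDvd.line_le {x y : D.Gen × (Fin 2 →₀ ℕ)} (h : BasisDvd x y) {t : ℝ}
    (ht : t ∈ Icc (0 : ℝ) 2) : line (gradingLine y) t ≤ line (gradingLine x) t := by
  have h0 : (x.2 0 : ℝ) ≤ y.2 0 := Nat.cast_le.2 (h.2 0)
  have h1 : (x.2 1 : ℝ) ≤ y.2 1 := Nat.cast_le.2 (h.2 1)
  rw [line_gradingLine, line_gradingLine, grt, grt, h.1]
  have := mul_le_mul_of_nonneg_left h0 ht.1
  have := mul_le_mul_of_nonneg_left h1 (sub_nonneg.2 ht.2)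
  linarith

variable (F D) in
/-- The cycles that represent nonzero elements of the homology modulo torsion. -/
abbrev FreeCycle : Type _ := {z : Cycles F D // freeClass F D z ≠ 0}

theorem FreeCycle.basisSupport_nonempty (z : FreeCycle F D) :
    (basisSupport (z.1 : CKh F D)).Nonempty :=
  LinkDiagram.basisSupport_nonempty fun h => z.2 (by
    rw [show z.1 = 0 from Subtype.ext h, freeClass, map_zero, map_zero])

variable (F D) in
/-- On `[0, 2]`, the number `gr_t(D)` is the maximum of finitely many minima of finitely many
affine functions of `t`. -/
theorem exists_grDiagram_eq : ∃ (s : Finset (FreeCycle F D)) (hs : s.Nonempty),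
    ∀ t ∈ Icc (0 : ℝ) 2, grDiagram F D t =
      ((s.sup' hs fun z => (basisSupport (z.1 : CKh F D)).inf' z.basisSupport_nonempty
        fun x => line (gradingLine x)) t : ℝ) := by
  obtain ⟨s, hs⟩ := exists_finset_forall_dominates (wellQuasiOrdered_basisDvd (D := D))
    fun z : FreeCycle F D => basisSupport (z.1 : CKh F D)
  obtain ⟨z₀, hz₀⟩ := exists_freeClass_ne_zero F D
  obtain ⟨j₀, hj₀, -⟩ := hs ⟨z₀, hz₀⟩
  have hne : s.Nonempty := ⟨j₀, hj₀⟩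
  refine ⟨s, hne, fun t ht => ?_⟩
  simp only [Finset.sup'_apply, Finset.inf'_apply]
  refine le_antisymm (sSup_le ?_) ?_
  · rintro _ ⟨η, hη, rfl⟩
    refine sSup_le ?_
    rintro _ ⟨b, hb, rfl⟩
    obtain ⟨z, hz, rfl⟩ := mem_filKhFree_iff.1 hb
    rw [mem_filCKh_iff] at hz
    -- Each basis element of `j` divides one of `z`, so the level of `j` is at least that of `z`.
    obtain ⟨j, hj, hjz⟩ := hs ⟨z, hη⟩
    refine EReal.coe_le_coe_iff.2 (Finset.le_sup'_of_le _ hj (Finset.le_inf' _ _ fun x hx => ?_))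
    obtain ⟨y, hy, hxy⟩ := hjz x hx
    exact (hz y hy).trans (hxy.line_le ht)
  · obtain ⟨j, -, hj⟩ := Finset.exists_mem_eq_sup' hne fun z : FreeCycle F D =>
      (basisSupport (z.1 : CKh F D)).inf' z.basisSupport_nonempty
        fun x => line (gradingLine x) t
    rw [hj]
    have hmem : freeClass F D j.1 ∈ filKhFree F D t
        ((basisSupport (j.1 : CKh F D)).inf' j.basisSupport_nonempty
          fun x => line (gradingLine x) t) :=
      mem_filKhFree_iff.2 ⟨j.1, mem_filCKh_iff.2 fun x hx => Finset.inf'_le _ hx, rfl⟩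
    have hle : _ ≤ grElem F D t (freeClass F D j.1) := le_sSup ⟨_, hmem, rfl⟩
    exact hle.trans (le_sSup ⟨_, j.2, rfl⟩)

end Filtration

end LinkDiagram
end

/-- For every field `F` and every diagram `D` of an oriented link, the invariant `s_t` is a
(finite) real number for each `t ∈ [0, 2]`, and as a function of `t` it is piecewise linear,
continuous, and differentiable at all but finitely many points. -/
theorem theorem3p14 (F : Type*) [Field F] (D : LinkDiagram) :
    ∃ s : ℝ → ℝ,
      (∀ t ∈ Set.Icc (0 : ℝ) 2, LinkDiagram.sInvariant F D t = (s t : EReal)) ∧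
      IsPiecewiseLinearOn s 0 2 ∧
      ContinuousOn s (Set.Icc 0 2) ∧
      {t ∈ Set.Icc (0 : ℝ) 2 | ¬ DifferentiableWithinAt ℝ s (Set.Icc 0 2) t}.Finite := by
  obtain ⟨s, hs, h⟩ := LinkDiagram.exists_grDiagram_eq F D
  have haff := (isAffineOffBreakpoints_sup'_inf' hs
    (fun z => LinkDiagram.basisSupport (z.1 : LinkDiagram.CKh F D))
    (fun z => z.basisSupport_nonempty) LinkDiagram.gradingLine).sub_const 1
  have hfin := finite_crossings s
    (fun z => LinkDiagram.basisSupport (z.1 : LinkDiagram.CKh F D)) LinkDiagram.gradingLine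
  refine ⟨_, fun t ht => ?_, haff.isPiecewiseLinearOn hfin zero_le_two, ?_, ?_⟩
  · rw [LinkDiagram.sInvariant, h t ht, EReal.coe_sub, EReal.coe_one]
  · exact ((continuous_sup'_inf'_line hs _ _ _).sub continuous_const).continuousOn
  · refine hfin.subset fun t ht => by_contra fun hP => ht.2 ?_
    exact (haff.differentiableAt hfin hP).differentiableWithinAt
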